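/- A border of a word $w$ is a non-empty proper prefix of $w$ that is also a suffix of $w$; a word is unbordered if it has no border. For $k\ge 1$ let $\Sigma_k=\{1,2,\ldots,k\}$ with $1<2<\cdots<k$. The rank of a length-$n$ unbordered word over $\Sigma_k$ is its position, counted from $1$, in the lexicographic listing of all length-$n$ unbordered words over $\Sigma_k$. Theorem. In the unit-cost RAM model (each memory cell holds one integer of arbitrary size, and each elementary arithmetic operation, comparison and memory access takes one unit of time; space is the number of memory cells used) there is an algorithm that, given integers $n\ge 1$, $k\ge 2$ and the rank $r$ of a length-$n$ unbordered word over $\Sigma_k$, computes the length-$n$ unbordered word $w\in\Sigma_k^n$ with rank $r$ in $O(n^4k\log k)$ time using $O(n)$ space, where the constants implied by the $O$-notation depend on none of $n$, $k$, $r$. -/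

import Mathlib

/-! ### Borders, lexicographic listing, rank

Words are lists of natural numbers; the alphabet with `k` letters is `{1, …, k}`. The order `≤` on
`List ℕ` is Mathlib's lexicographic order. -/

/-- `u` is a border of `w`: a non-empty proper prefix of `w` that is also a suffix of `w`. -/
def IsBorder (u w : List ℕ) : Prop :=
  u ≠ [] ∧ u ≠ w ∧ u <+: w ∧ u <:+ w

/-- A word is bordered if it has a border. -/
def Bordered (w : List ℕ) : Prop := ∃ u, IsBorder u w

/-- A word is unbordered if it has no border. -/
def Unbordered (w : List ℕ) : Prop := ¬ Bordered w

/-- All words of length `n` over the alphabet `{1, …, k}`. -/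
def words (k n : ℕ) : Finset (List ℕ) :=
  (Fintype.piFinset fun _ : Fin n => Finset.Icc 1 k).image List.ofFn

open Classical in
/-- All unbordered words of length `n` over `{1, …, k}`. -/
noncomputable def unborderedWords (k n : ℕ) : Finset (List ℕ) :=
  (words k n).filter Unbordered

/-- The lexicographic listing (increasing, without repetition) of the unbordered words of
length `n` over `{1, …, k}`. -/
noncomputable def unborderedListing (k n : ℕ) : List (List ℕ) :=
  (unborderedWords k n).sort (· ≤ ·)

/-- The rank of an unbordered word `w` over `{1, …, k}`: its position, counted from `1`, in the
lexicographic listing of the unbordered words of length `|w|`. -/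
noncomputable def rankU (k : ℕ) (w : List ℕ) : ℕ :=
  (unborderedListing k w.length).idxOf w + 1

/-! ### The unit-cost random access machine

The memory consists of cells with addresses `0, 1, 2, …`, each of which holds one integer of any
size. Programs are finite structured programs. Every constant, every memory access, every
arithmetic operation or comparison, every test and every assignment costs one unit of time.
Addresses may be computed (indirect addressing). -/

namespace RAM

/-- Contents of the memory. -/
abbrev Mem := ℕ → ℤ

/-- The elementary operations on integers; the comparisons return `1` (true) or `0` (false). -/
inductive Op
  | add | sub | mul | div | lt | eq

/-- Value of an elementary operation (`div` is integer division). -/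
def Op.eval : Op → ℤ → ℤ → ℤ
  | .add, x, y => x + y
  | .sub, x, y => x - y
  | .mul, x, y => x * y
  | .div, x, y => x / y
  | .lt, x, y => if x < y then 1 else 0
  | .eq, x, y => if x = y then 1 else 0

/-- Expressions; `load a` is the content of the cell whose address is the value of `a`. -/
inductive Expr
  | const (z : ℤ)
  | load (a : Expr)
  | bin (o : Op) (a b : Expr)

/-- Value of an expression. -/
def Expr.eval (m : Mem) : Expr → ℤ
  | .const z => z
  | .load a => m (a.eval m).toNat
  | .bin o a b => o.eval (a.eval m) (b.eval m)

/-- Time to evaluate an expression: one unit for each constant, each memory access and each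
elementary operation. -/
def Expr.cost : Expr → ℕ
  | .const _ => 1
  | .load a => a.cost + 1
  | .bin _ a b => a.cost + b.cost + 1

/-- Every cell that is read during the evaluation has one of the addresses `0, …, s - 1`. -/
def Expr.Within (s : ℕ) (m : Mem) : Expr → Prop
  | .const _ => True
  | .load a => a.Within s m ∧ 0 ≤ a.eval m ∧ a.eval m < s
  | .bin _ a b => a.Within s m ∧ b.Within s m

/-- Programs. `store a e` writes the value of `e` into the cell whose address is the value
of `a`; a test succeeds if the value of the expression is not `0`. -/
inductive Prog
  | skip
  | store (a e : Expr)
  | seq (p q : Prog)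
  | ite (c : Expr) (p q : Prog)
  | loop (c : Expr) (p : Prog)

/-- `Exec s p m t m'`: started on memory `m`, the program `p` halts after exactly `t` units of
time with memory `m'`, and only cells with addresses `0, …, s - 1` are read or written. -/
inductive Exec (s : ℕ) : Prog → Mem → ℕ → Mem → Prop
  | skip (m : Mem) : Exec s .skip m 1 m
  | store (a e : Expr) (m : Mem) (i : ℕ) (ha : a.Within s m) (he : e.Within s m)
      (hi : a.eval m = (i : ℤ)) (his : i < s) :
      Exec s (.store a e) m (a.cost + e.cost + 1) (Function.update m i (e.eval m))
  | seq (p q : Prog) (m₁ m₂ m₃ : Mem) (t₁ t₂ : ℕ) (hp : Exec s p m₁ t₁ m₂)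
      (hq : Exec s q m₂ t₂ m₃) : Exec s (.seq p q) m₁ (t₁ + t₂) m₃
  | iteTrue (c : Expr) (p q : Prog) (m m' : Mem) (t : ℕ) (hc : c.Within s m)
      (h : c.eval m ≠ 0) (hp : Exec s p m t m') : Exec s (.ite c p q) m (c.cost + 1 + t) m'
  | iteFalse (c : Expr) (p q : Prog) (m m' : Mem) (t : ℕ) (hc : c.Within s m)
      (h : c.eval m = 0) (hq : Exec s q m t m') : Exec s (.ite c p q) m (c.cost + 1 + t) m'
  | loopDone (c : Expr) (p : Prog) (m : Mem) (hc : c.Within s m) (h : c.eval m = 0) :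
      Exec s (.loop c p) m (c.cost + 1) m
  | loopStep (c : Expr) (p : Prog) (m₁ m₂ m₃ : Mem) (t₁ t₂ : ℕ) (hc : c.Within s m₁)
      (h : c.eval m₁ ≠ 0) (hp : Exec s p m₁ t₁ m₂) (hl : Exec s (.loop c p) m₂ t₂ m₃) :
      Exec s (.loop c p) m₁ (c.cost + 1 + t₁ + t₂) m₃

/-- The initial memory: the input occupies the cells `0, 1, …`, all other cells hold `0`. -/
def input (x : List ℕ) : Mem := fun i => (x.getD i 0 : ℕ)

/-- On input `x`, the program `p` halts after `t` units of time within a memory of `s` cells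
(input and output included), and the output `y` is then stored in the consecutive
cells `out, out + 1, …`. -/
def Computes (p : Prog) (out : ℕ) (x y : List ℕ) (t s : ℕ) : Prop :=
  x.length ≤ s ∧ out + y.length ≤ s ∧
    ∃ m : Mem, Exec s p (input x) t m ∧ ∀ i (hi : i < y.length), m (out + i) = (y[i] : ℤ)

end RAM

/-! The word of a given rank is found letter by letter. Suppose that its first `m` letters are known
and that `r` is its rank among the unbordered words with these first letters. The letters
`c = 1, 2, …` are tried in turn: if there are `F` unbordered words of length `n` that continue the
known letters by `c`, then the sought letter is `c` if `r ≤ F`; otherwise `r` is replaced by `r - F`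
and `c` by the next letter (`extCount_lt_remRank`, `remRank_le_extCount`, `remRank_eq_add`).

The number `F` comes from a recurrence (`unbCount_add_sum`). A pattern `P` consists of some fixed
letters followed by holes. The shortest border of a bordered word of length `j` is unbordered and
has length `b ≤ j / 2`, and no other border of the word is unbordered. So the words of length `j`
that match `P` fall into the unbordered ones and, for each `b` with `2 * b ≤ j`, those that have an
unbordered border of length `b`. Once an unbordered word `u` of length `b` that matches `P` is
chosen as the border, the positions from `b` on can be filled independently: a position in the
middle admits `k` letters or one, according as `P` has a hole there, and a position in the final
copy of `u` admits one letter or none, according as `P` is compatible with its own shift by `j - b`.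
This last condition does not depend on `u`, because if `P` fixes a position, it fixes all earlier
ones. Hence the class of `b` has `unbCount k P b * ∏ i ∈ Ico b j, choices k P j b i` elements.

Evaluating the recurrence for all `j ≤ n`, with the product recomputed for each pair `(j, b)`, takes
`O(n ^ 3)` time and a table of `n + 1` cells. It is done at most `n * k` times, so the total time is
`O(n ^ 4 * k)`, which is `O(n ^ 4 * k * log k)` as `log k ≥ log 2`.

The program is verified by timed Hoare rules: `RAM.Run n k p T σ Q` bounds the time and the space,
and each loop has an invariant indexed by the number of passes (`RAM.Run.loop`). -/

open Finset

/-! ### Words with prescribed sets of letters -/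

/-- The words of length `n` whose `i`-th letter is taken from `opts i`. -/
def wordsOf (opts : ℕ → Finset ℕ) (n : ℕ) : Finset (List ℕ) :=
  (Fintype.piFinset fun i : Fin n => opts i).image List.ofFn

lemma mem_wordsOf {opts : ℕ → Finset ℕ} {n : ℕ} {v : List ℕ} :
    v ∈ wordsOf opts n ↔ v.length = n ∧ ∀ i < n, v.getD i 0 ∈ opts i := by
  simp only [wordsOf, mem_image, Fintype.mem_piFinset]
  constructor
  · rintro ⟨f, hf, rfl⟩
    refine ⟨by simp, fun i hi => ?_⟩
    simpa [List.getD_eq_getElem?_getD, hi] using hf ⟨i, hi⟩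
  · rintro ⟨rfl, h⟩
    refine ⟨fun i => v.getD i 0, fun i => h i i.2, ?_⟩
    apply List.ext_getElem <;> simp +contextual

lemma card_wordsOf (opts : ℕ → Finset ℕ) (n : ℕ) :
    #(wordsOf opts n) = ∏ i ∈ range n, #(opts i) := by
  rw [wordsOf, card_image_of_injective _ List.ofFn_injective, Fintype.card_piFinset,
    Fin.prod_univ_eq_prod_range (fun i => #(opts i))]

lemma mem_words {k n : ℕ} {v : List ℕ} :
    v ∈ words k n ↔ v.length = n ∧ ∀ i < n, v.getD i 0 ∈ Icc 1 k :=
  mem_wordsOf (opts := fun _ => Icc 1 k)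

lemma mem_unborderedWords {k n : ℕ} {v : List ℕ} :
    v ∈ unborderedWords k n ↔
      v.length = n ∧ (∀ i < n, v.getD i 0 ∈ Icc 1 k) ∧ Unbordered v := by
  simp [unborderedWords, mem_words, and_assoc]

/-! ### Borders by length -/

/-- `w` has a border of length `b`. -/
def HasBorder (w : List ℕ) (b : ℕ) : Prop :=
  0 < b ∧ b < w.length ∧ ∀ i < b, w.getD i 0 = w.getD (w.length - b + i) 0

lemma getD_take {w : List ℕ} {b i : ℕ} (h : i < b) : (w.take b).getD i 0 = w.getD i 0 := by
  simp [List.getD_eq_getElem?_getD, h]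

lemma eq_of_getD {u v : List ℕ} (hl : u.length = v.length)
    (h : ∀ i < v.length, u.getD i 0 = v.getD i 0) : u = v := by
  apply List.ext_getElem hl
  intro i h1 h2
  simpa [h1, h2] using h i h2

lemma bordered_iff {w : List ℕ} : Bordered w ↔ ∃ b, HasBorder w b := by
  constructor
  · rintro ⟨u, h0, hne, hp, hs⟩
    have hlt : u.length < w.length := lt_of_le_of_ne hp.length_le fun h => hne (hp.eq_of_length h)
    refine ⟨u.length, List.length_pos_iff.2 h0, hlt, fun i hi => ?_⟩
    obtain ⟨x, rfl⟩ := hp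
    obtain ⟨y, hy⟩ := hs
    have hyl : y.length = (u ++ x).length - u.length := by
      have := congrArg List.length hy
      simp only [List.length_append] at this ⊢
      omega
    rw [← hyl, List.getD_append _ _ _ _ hi, ← hy, List.getD_append_right _ _ _ _ (by omega)]
    congr 1
    omega
  · rintro ⟨b, h0, hlt, h⟩
    refine ⟨w.take b, ?_, ?_, List.take_prefix _ _, ?_⟩
    · intro e
      have := congrArg List.length e
      simp at this
      rcases this with h | h
      · omega
      · simp [h] at hlt
    · intro e
      have := congrArg List.length e
      simp at this
      omega
    · have : w.take b = w.drop (w.length - b) := by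
        apply eq_of_getD
        · simp; omega
        · intro i hi
          have hi : i < b := by simp at hi; omega
          rw [getD_take hi, h i hi]
          simp [List.getD_eq_getElem?_getD]
      rw [this]
      exact List.drop_suffix _ _

/-- A border longer than half of the word overlaps itself, and the overlap is a shorter border. -/
lemma HasBorder.overlap {w : List ℕ} {b : ℕ} (h : HasBorder w b) (hb : w.length < 2 * b) :
    HasBorder w (2 * b - w.length) := by
  obtain ⟨h0, hlt, h⟩ := h
  refine ⟨by omega, by omega, fun i hi => ?_⟩
  rw [h i (by omega), h (w.length - b + i) (by omega)]
  congr 1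
  omega

/-- A border of a border is a border. -/
lemma HasBorder.of_take {w : List ℕ} {b c : ℕ} (h : HasBorder w b) (hc : HasBorder (w.take b) c) :
    HasBorder w c := by
  obtain ⟨h0, hlt, h⟩ := h
  obtain ⟨c0, clt, hc⟩ := hc
  have hl : (w.take b).length = b := by simp; omega
  rw [hl] at clt hc
  refine ⟨c0, by omega, fun i hi => ?_⟩
  have := hc i hi
  rw [getD_take (by omega), getD_take (by omega)] at this
  rw [this, h _ (by omega)]
  congr 1
  omega

/-- The shorter of two borders is a border of the longer one. -/
lemma HasBorder.take {w : List ℕ} {b c : ℕ} (h : HasBorder w b) (hc : HasBorder w c) (hcb : c < b) :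
    HasBorder (w.take b) c := by
  obtain ⟨h0, hlt, h⟩ := h
  obtain ⟨c0, clt, hc⟩ := hc
  have hl : (w.take b).length = b := by simp; omega
  refine ⟨c0, by omega, fun i hi => ?_⟩
  rw [hl, getD_take (by omega), getD_take (by omega), hc i hi, h (b - c + i) (by omega)]
  congr 1
  omega

/-- Every bordered word has an unbordered border of at most half its length: the shortest one. -/
lemma exists_shortest_border {w : List ℕ} (hw : Bordered w) :
    ∃ b, 0 < b ∧ 2 * b ≤ w.length ∧ HasBorder w b ∧ Unbordered (w.take b) := by
  classical
  have hex := bordered_iff.1 hw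
  refine ⟨Nat.find hex, (Nat.find_spec hex).1, ?_, Nat.find_spec hex, ?_⟩
  · by_contra hlt
    have h := Nat.find_spec hex
    have := Nat.find_min' hex (h.overlap (by omega))
    have := h.2.1
    omega
  · intro hb
    obtain ⟨c, hc⟩ := bordered_iff.1 hb
    have := Nat.find_min' hex ((Nat.find_spec hex).of_take hc)
    have h2 := hc.2.1
    simp only [List.length_take, lt_inf_iff] at h2
    omega

/-- A word has at most one unbordered border. -/
lemma unbordered_border_unique {w : List ℕ} {b c : ℕ} (hb : HasBorder w b)
    (ub : Unbordered (w.take b)) (hc : HasBorder w c) (uc : Unbordered (w.take c)) : b = c := by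
  rcases lt_trichotomy b c with h | h | h
  · exact absurd (bordered_iff.2 ⟨b, hc.take hb h⟩) uc
  · exact h
  · exact absurd (bordered_iff.2 ⟨c, hb.take hc h⟩) ub

/-! ### Counting the unbordered words that match a pattern -/

/-- The letters that a pattern `P` allows at position `i`. The value `0`, which is not a letter,
is a hole: any letter of `{1, …, k}` may stand there. -/
def opts (k : ℕ) (P : ℕ → ℕ) (i : ℕ) : Finset ℕ :=
  if P i = 0 then Icc 1 k else {P i}

open Classical in
/-- The number of unbordered words of length `j` that match the pattern `P`. -/
noncomputable def unbCount (k : ℕ) (P : ℕ → ℕ) (j : ℕ) : ℕ :=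
  #{v ∈ wordsOf (opts k P) j | Unbordered v}

/-- The number of choices at position `i`, `b ≤ i < j`, for a word of length `j` that matches `P`
and has a given border of length `b`, where `2 * b ≤ j`. For `b = 0` this is the number of letters
that `P` allows at position `i`. -/
def choices (k : ℕ) (P : ℕ → ℕ) (j b i : ℕ) : ℕ :=
  if i < j - b then (if P i = 0 then k else 1)
  else if P i = 0 ∨ P i = P (i - (j - b)) then 1 else 0

open Classical in
/-- The matching words with a prescribed unbordered border `u` of length `b` form a product set.
Whether `u` fits at the end depends on the pattern alone, since a position that the pattern fixes
there is the copy of a position that it fixes at the beginning. -/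
lemma card_border_fiber (k : ℕ) (P : ℕ → ℕ) (hP : ∀ i i', i ≤ i' → P i = 0 → P i' = 0)
    (hPk : ∀ i, P i ≤ k)
    {j b : ℕ} (hb : 0 < b) (hbj : 2 * b ≤ j) {u : List ℕ} (hu : u ∈ wordsOf (opts k P) b)
    (hun : Unbordered u) :
    #{v ∈ {v ∈ wordsOf (opts k P) j | HasBorder v b ∧ Unbordered (v.take b)} | v.take b = u} =
      ∏ i ∈ Ico b j, choices k P j b i := by
  set o : ℕ → Finset ℕ := fun i =>
    if i < b then {u.getD i 0} else if i < j - b then opts k P i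
    else if P i = 0 ∨ P i = P (i - (j - b)) then {u.getD (i - (j - b)) 0} else ∅ with ho
  obtain ⟨hul, hu⟩ := mem_wordsOf.1 hu
  have hset : {v ∈ {v ∈ wordsOf (opts k P) j | HasBorder v b ∧ Unbordered (v.take b)} |
      v.take b = u} = wordsOf o j := by
    ext v
    simp only [mem_filter, mem_wordsOf]
    constructor
    · rintro ⟨⟨⟨hl, hv⟩, hbd, -⟩, hvu⟩
      refine ⟨hl, fun i hi => ?_⟩
      have hpre : ∀ i < b, v.getD i 0 = u.getD i 0 := fun i hi => by
        rw [← hvu, getD_take hi]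
      simp only [ho]
      split_ifs with h1 h2 h3
      · rw [hpre i h1, mem_singleton]
      · exact hv i hi
      · have := hbd.2.2 (i - (j - b)) (by omega)
        rw [hl, show j - b + (i - (j - b)) = i by omega] at this
        rw [mem_singleton, ← this, hpre _ (by omega)]
      · exfalso
        have := hbd.2.2 (i - (j - b)) (by omega)
        rw [hl, show j - b + (i - (j - b)) = i by omega, hpre _ (by omega)] at this
        push Not at h3
        have h4 : P (i - (j - b)) ≠ 0 := fun h => h3.1 (hP _ _ (by omega) h)
        have h5 := hu (i - (j - b)) (by omega)
        have h6 := hv i hi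
        simp only [opts, h4, h3.1, if_false, mem_singleton] at h5 h6
        exact h3.2 (by rw [← h6, ← h5, this])
    · rintro ⟨hl, hv⟩
      have hpre : ∀ i < b, v.getD i 0 = u.getD i 0 := fun i hi => by
        have := hv i (by omega)
        simpa [ho, hi] using this
      have htake : v.take b = u := by
        apply eq_of_getD
        · simp; omega
        · intro i hi
          rw [getD_take (by omega), hpre i (by omega)]
      refine ⟨⟨⟨hl, fun i hi => ?_⟩, ⟨hb, by omega, fun i hi => ?_⟩, htake ▸ hun⟩, htake⟩
      · rcases lt_or_ge i b with h1 | h1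
        · rw [hpre i h1]; exact hu i h1
        have h2 := hv i hi
        simp only [ho] at h2
        rw [if_neg (by omega)] at h2
        split_ifs at h2 with h3 h4
        · exact h2
        · rw [mem_singleton] at h2
          have h5 := hu (i - (j - b)) (by omega)
          rw [h2]
          unfold opts at h5 ⊢
          split_ifs with h6
          · split_ifs at h5 with h7
            · exact h5
            · rw [mem_singleton] at h5
              rw [h5, mem_Icc]
              exact ⟨Nat.pos_of_ne_zero h7, hPk _⟩
          · have h7 := h4.resolve_left h6
            rw [if_neg (by omega)] at h5
            rw [h7]; exact h5
        · simp at h2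
      · have h2 := hv (j - b + i) (by omega)
        simp only [ho] at h2
        rw [if_neg (by omega), if_neg (by omega)] at h2
        split_ifs at h2 with h4
        · rw [mem_singleton, show j - b + i - (j - b) = i by omega] at h2
          rw [hl, h2, hpre i hi]
        · simp at h2
  rw [hset, card_wordsOf, range_eq_Ico, ← prod_Ico_consecutive _ (Nat.zero_le b) (by omega : b ≤ j)]
  rw [prod_eq_one (s := Ico 0 b) (fun i hi => by
    have := (mem_Ico.1 hi).2
    simp [ho, this]), one_mul]
  refine prod_congr rfl fun i hi => ?_
  have hbi := (mem_Ico.1 hi).1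
  simp only [ho, choices, opts, if_neg (not_lt.2 hbi)]
  split_ifs <;> simp

open Classical in
/-- The number of matching words with an unbordered border of length `b`: the number of borders
times the number of ways to complete each of them. -/
lemma card_border_length (k : ℕ) (P : ℕ → ℕ) (hP : ∀ i i', i ≤ i' → P i = 0 → P i' = 0)
    (hPk : ∀ i, P i ≤ k) {j b : ℕ} (hb : 0 < b) (hbj : 2 * b ≤ j) :
    #{v ∈ wordsOf (opts k P) j | HasBorder v b ∧ Unbordered (v.take b)} =
      unbCount k P b * ∏ i ∈ Ico b j, choices k P j b i := by
  rw [card_eq_sum_card_fiberwise (f := List.take b)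
    (t := {u ∈ wordsOf (opts k P) b | Unbordered u})]
  · rw [unbCount, ← smul_eq_mul, ← sum_const]
    refine sum_congr rfl fun u hu => ?_
    obtain ⟨hu, hun⟩ := mem_filter.1 hu
    exact card_border_fiber k P hP hPk hb hbj hu hun
  · intro v hv
    simp only [coe_filter, Set.mem_ofPred_eq, mem_wordsOf] at hv ⊢
    obtain ⟨⟨hl, hv⟩, hbd, hun⟩ := hv
    exact ⟨⟨by simp; omega, fun i hi => by rw [getD_take hi]; exact hv i (by omega)⟩, hun⟩

/-- The recurrence behind the algorithm: each bordered word is counted once, under the length `b`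
of its unbordered border. -/
lemma unbCount_add_sum (k : ℕ) (P : ℕ → ℕ) (hP : ∀ i i', i ≤ i' → P i = 0 → P i' = 0)
    (hPk : ∀ i, P i ≤ k) (j : ℕ) :
    unbCount k P j + ∑ b ∈ Ico 1 (j / 2 + 1), unbCount k P b * ∏ i ∈ Ico b j, choices k P j b i =
      ∏ i ∈ Ico 0 j, choices k P j 0 i := by
  classical
  have htot : #(wordsOf (opts k P) j) = ∏ i ∈ Ico 0 j, choices k P j 0 i := by
    rw [card_wordsOf, range_eq_Ico]
    refine prod_congr rfl fun i hi => ?_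
    have := (mem_Ico.1 hi).2
    simp only [opts, choices, Nat.sub_zero, this, if_true]
    split_ifs <;> simp
  rw [← htot, ← card_filter_add_card_filter_not (s := wordsOf (opts k P) j) Unbordered, unbCount]
  congr 1
  have hU : {v ∈ wordsOf (opts k P) j | ¬ Unbordered v} = (Ico 1 (j / 2 + 1)).biUnion fun b =>
      {v ∈ wordsOf (opts k P) j | HasBorder v b ∧ Unbordered (v.take b)} := by
    ext v
    rw [mem_filter, mem_biUnion, Unbordered, not_not]
    constructor
    · rintro ⟨hv, hb⟩
      obtain ⟨b, h0, h2, h3, h4⟩ := exists_shortest_border hb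
      have := (mem_wordsOf.1 hv).1
      exact ⟨b, mem_Ico.2 (by omega), mem_filter.2 ⟨hv, h3, h4⟩⟩
    · rintro ⟨b, -, hb⟩
      obtain ⟨hv, h3, -⟩ := mem_filter.1 hb
      exact ⟨hv, bordered_iff.2 ⟨b, h3⟩⟩
  rw [hU, card_biUnion]
  · refine sum_congr rfl fun b hb => ?_
    have := mem_Ico.1 hb
    exact (card_border_length k P hP hPk (by omega) (by omega)).symm
  · intro b _ c _ hbc
    refine disjoint_left.2 fun v hv hv' => hbc ?_
    obtain ⟨-, h1, h2⟩ := mem_filter.1 hv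
    obtain ⟨-, h3, h4⟩ := mem_filter.1 hv'
    exact unbordered_border_unique h1 h2 h3 h4

/-- The table that the algorithm fills: the numbers `unbCount k P j`, preceded by `-1`. -/
noncomputable def countTable (k : ℕ) (P : ℕ → ℕ) (j : ℕ) : ℤ :=
  if j = 0 then -1 else unbCount k P j

/-- The value `-1` at `0` turns the total number of matching words into the summand `b = 0`. -/
lemma countTable_eq (k : ℕ) (P : ℕ → ℕ) (hP : ∀ i i', i ≤ i' → P i = 0 → P i' = 0)
    (hPk : ∀ i, P i ≤ k) {j : ℕ} (hj : 0 < j) :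
    countTable k P j =
      - ∑ b ∈ range (j / 2 + 1), countTable k P b * ∏ i ∈ Ico b j, (choices k P j b i : ℤ) := by
  have h := unbCount_add_sum k P hP hPk j
  rw [range_eq_Ico, sum_eq_sum_Ico_succ_bot (by omega)]
  have h2 : ∑ b ∈ Ico (0 + 1) (j / 2 + 1),
      countTable k P b * ∏ i ∈ Ico b j, (choices k P j b i : ℤ) =
      ∑ b ∈ Ico 1 (j / 2 + 1), (unbCount k P b : ℤ) * ∏ i ∈ Ico b j, (choices k P j b i : ℤ) := by
    refine sum_congr rfl fun b hb => ?_
    have := (mem_Ico.1 hb).1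
    rw [countTable, if_neg (by omega)]
  rw [h2, countTable, if_neg hj.ne', countTable, if_pos rfl]
  have h3 := congrArg (Nat.cast : ℕ → ℤ) h
  push_cast at h3
  linarith

/-! ### Ranks and prefixes -/

/-- In a strictly increasing list, the position of an element, counted from `1`, is the number of
elements up to it. -/
lemma idxOf_add_one_eq_card {α : Type*} [LinearOrder α] [BEq α] [LawfulBEq α] {l : List α}
    (hl : l.Pairwise (· < ·)) {w : α} (hw : w ∈ l) :
    l.idxOf w + 1 = (l.filter (· ≤ w)).length := by
  induction l with
  | nil => simp at hw
  | cons a t ih =>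
    obtain ⟨h1, h2⟩ := List.pairwise_cons.1 hl
    rcases eq_or_ne a w with rfl | hne
    · have : t.filter (· ≤ a) = [] := by
        simpa using fun b hb => h1 b hb
      simp [this]
    · have hwt : w ∈ t := by simpa [hne.symm] using hw
      rw [List.idxOf_cons_ne _ hne, List.filter_cons_of_pos (by simpa using (h1 w hwt).le),
        List.length_cons, ← ih h2 hwt]

lemma rankU_eq_card {k n : ℕ} {w : List ℕ} (hw : w ∈ unborderedWords k n) :
    rankU k w = #{v ∈ unborderedWords k n | v ≤ w} := by
  have hl := (mem_unborderedWords.1 hw).1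
  have hs : ((unborderedWords k n).sort (· ≤ ·)).Pairwise (· < ·) := sortedLT_sort _ |>.pairwise
  rw [rankU, unborderedListing, hl, idxOf_add_one_eq_card hs (by simpa using hw),
    ← List.toFinset_card_of_nodup (hs.nodup.filter _)]
  congr 1
  ext v
  simp

/-- Words that first differ at position `m` are ordered by their letters there. -/
lemma lt_of_take_eq {u v : List ℕ} {m : ℕ} (hu : m < u.length) (hv : m < v.length)
    (h : u.take m = v.take m) (hlt : u.getD m 0 < v.getD m 0) : u < v := by
  induction m generalizing u v with
  | zero =>
    cases u <;> cases v <;> simp_all [List.cons_lt_cons_iff]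
  | succ m ih =>
    cases u <;> cases v <;> simp_all

/-- The number of unbordered words up to `w` that share the first `m` letters with `w` and
continue with a letter at least `c`. -/
noncomputable def remRank (k n : ℕ) (w : List ℕ) (m c : ℕ) : ℕ :=
  #{v ∈ unborderedWords k n | v ≤ w ∧ v.take m = w.take m ∧ c ≤ v.getD m 0}

/-- The pattern given by the first `m` letters of `w` followed by the letter `c`. -/
def prefixPattern (w : List ℕ) (m c i : ℕ) : ℕ :=
  if i < m then w.getD i 0 else if i = m then c else 0

lemma remRank_zero_zero {k n : ℕ} {w : List ℕ} (hw : w ∈ unborderedWords k n) :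
    remRank k n w 0 0 = rankU k w := by
  simp [remRank, rankU_eq_card hw]

lemma remRank_pos {k n : ℕ} {w : List ℕ} (hw : w ∈ unborderedWords k n) {m c : ℕ}
    (hc : c ≤ w.getD m 0) : 0 < remRank k n w m c :=
  card_pos.2 ⟨w, mem_filter.2 ⟨hw, le_rfl, rfl, hc⟩⟩

lemma take_succ_eq_iff {v w : List ℕ} {m : ℕ} (hv : m < v.length) (hw : m < w.length) :
    v.take (m + 1) = w.take (m + 1) ↔ v.take m = w.take m ∧ v.getD m 0 = w.getD m 0 := by
  rw [List.take_succ_eq_append_getElem hv, List.take_succ_eq_append_getElem hw]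
  constructor
  · intro h
    have := List.append_inj' h rfl
    simpa [hv, hw] using this
  · rintro ⟨h1, h2⟩
    simp only [hv, hw, List.getD_eq_getElem] at h2
    rw [h1, h2]

lemma remRank_succ {k n : ℕ} {w : List ℕ} (hw : w ∈ unborderedWords k n) {m : ℕ} (hm : m < n) :
    remRank k n w (m + 1) 0 = remRank k n w m (w.getD m 0) := by
  have hwl := (mem_unborderedWords.1 hw).1
  unfold remRank
  congr 1
  refine filter_congr fun v hv => ?_
  have hvl := (mem_unborderedWords.1 hv).1
  rw [take_succ_eq_iff (by omega) (by omega)]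
  constructor
  · rintro ⟨h1, ⟨h2, h3⟩, -⟩
    exact ⟨h1, h2, h3.ge⟩
  · rintro ⟨h1, h2, h3⟩
    refine ⟨h1, ⟨h2, le_antisymm (not_lt.1 fun h4 => ?_) h3⟩, Nat.zero_le _⟩
    exact absurd h1 (not_le.2 (lt_of_take_eq (by omega) (by omega) h2.symm h4))

lemma unbCount_prefixPattern {k n : ℕ} {w : List ℕ} (hw : w ∈ unborderedWords k n) {m c : ℕ}
    (hm : m < n) (hc : 0 < c) (hck : c ≤ k) :
    unbCount k (prefixPattern w m c) n =
      #{v ∈ unborderedWords k n | v.take m = w.take m ∧ v.getD m 0 = c} := by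
  classical
  obtain ⟨hwl, hwk, -⟩ := mem_unborderedWords.1 hw
  rw [unbCount]
  congr 1
  ext v
  simp only [mem_filter, mem_wordsOf, mem_unborderedWords]
  constructor
  · rintro ⟨⟨hl, hv⟩, hun⟩
    have hpre : ∀ i < m, v.getD i 0 = w.getD i 0 := fun i hi => by
      have h1 := hv i (by omega)
      have h2 := mem_Icc.1 (hwk i (by omega))
      rwa [opts, prefixPattern, if_pos hi, if_neg (by omega), mem_singleton] at h1
    have hmc : v.getD m 0 = c := by
      have h1 := hv m hm
      rwa [opts, prefixPattern, if_neg (lt_irrefl _), if_pos rfl, if_neg hc.ne',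
        mem_singleton] at h1
    refine ⟨⟨hl, fun i hi => ?_, hun⟩, ?_, hmc⟩
    · rcases lt_trichotomy i m with h | rfl | h
      · rw [hpre i h]; exact hwk i hi
      · rw [hmc, mem_Icc]; exact ⟨hc, hck⟩
      · have h1 := hv i hi
        rwa [opts, prefixPattern, if_neg (by omega : ¬ i < m),
          if_neg (by omega : ¬ i = m), if_pos rfl] at h1
    · apply eq_of_getD
      · simp; omega
      · intro i hi
        have hi : i < m := by simp at hi; omega
        rw [getD_take hi, getD_take hi, hpre i hi]
  · rintro ⟨⟨hl, hv, hun⟩, h1, h2⟩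
    refine ⟨⟨hl, fun i hi => ?_⟩, hun⟩
    rcases lt_trichotomy i m with h | rfl | h
    · have h3 := mem_Icc.1 (hwk i hi)
      rw [opts, prefixPattern, if_pos h, if_neg (by omega), mem_singleton, ← getD_take h, h1,
        getD_take h]
    · rw [opts, prefixPattern, if_neg (lt_irrefl _), if_pos rfl, if_neg hc.ne', mem_singleton, h2]
    · rw [opts, prefixPattern, if_neg (by omega : ¬ i < m),
          if_neg (by omega : ¬ i = m), if_pos rfl]
      exact hv i hi

/-- The number of unbordered words that continue the first `m` letters of `w` by `c`; there are
none for `c = 0`, which is not a letter. -/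
noncomputable def extCount (k n : ℕ) (w : List ℕ) (m c : ℕ) : ℕ :=
  #{v ∈ unborderedWords k n | v.take m = w.take m ∧ v.getD m 0 = c}

lemma extCount_zero {k n : ℕ} (w : List ℕ) {m : ℕ} (hm : m < n) : extCount k n w m 0 = 0 := by
  rw [extCount, card_eq_zero, filter_eq_empty_iff]
  rintro v hv ⟨-, h⟩
  have := mem_Icc.1 ((mem_unborderedWords.1 hv).2.1 m hm)
  omega

lemma remRank_eq_add {k n : ℕ} {w : List ℕ} (hw : w ∈ unborderedWords k n) {m c : ℕ} (hm : m < n)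
    (hc : c < w.getD m 0) :
    remRank k n w m c = extCount k n w m c + remRank k n w m (c + 1) := by
  have hwl := (mem_unborderedWords.1 hw).1
  rw [remRank, extCount, remRank, ← card_union_of_disjoint]
  · congr 1
    ext v
    simp only [mem_union, mem_filter]
    constructor
    · rintro ⟨h1, h2, h3, h4⟩
      rcases h4.eq_or_lt with h | h
      · exact Or.inl ⟨h1, h3, h.symm⟩
      · exact Or.inr ⟨h1, h2, h3, h⟩
    · rintro (⟨h1, h2, h3⟩ | ⟨h1, h2, h3, h4⟩)
      · have hvl := (mem_unborderedWords.1 h1).1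
        exact ⟨h1, (lt_of_take_eq (by omega) (by omega) h2 (by omega)).le, h2, h3.ge⟩
      · exact ⟨h1, h2, h3, by omega⟩
  · refine disjoint_left.2 fun v hv hv' => ?_
    have h1 := (mem_filter.1 hv).2.2
    have h2 := (mem_filter.1 hv').2.2.2
    omega

/-- The scan over the letters passes every letter smaller than that of `w`. -/
lemma extCount_lt_remRank {k n : ℕ} {w : List ℕ} (hw : w ∈ unborderedWords k n) {m c : ℕ}
    (hm : m < n) (hc : c < w.getD m 0) : extCount k n w m c < remRank k n w m c := by
  have := remRank_eq_add hw hm hc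
  have := remRank_pos hw (m := m) (c := c + 1) hc
  omega

/-- The scan over the letters stops at the letter of `w`. -/
lemma remRank_le_extCount {k n : ℕ} {w : List ℕ} (hw : w ∈ unborderedWords k n) {m : ℕ}
    (hm : m < n) : remRank k n w m (w.getD m 0) ≤ extCount k n w m (w.getD m 0) := by
  have hwl := (mem_unborderedWords.1 hw).1
  refine card_le_card fun v hv => ?_
  simp only [mem_filter] at hv ⊢
  obtain ⟨h0, h1, h2, h3⟩ := hv
  have hvl := (mem_unborderedWords.1 h0).1
  refine ⟨h0, h2, le_antisymm (not_lt.1 fun h4 => ?_) h3⟩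
  exact absurd h1 (not_le.2 (lt_of_take_eq (by omega) (by omega) h2.symm h4))

namespace RAM

/-! ### Memory states and timed execution -/

/-- The contents of the working memory apart from the inputs `n` and `k`: eight variables, the
pattern `W` (the letters found so far, followed by zeros) and the table `Fa` of counts. Here `r` is
the remaining rank, `F` the count for the current letter, `m` the current position, `j`, `b` and
`i` are the loop variables of the recurrence, `acc` and `prod` its partial sum and product. -/
structure State where
  r : ℤ
  m : ℕ
  j : ℕ
  b : ℕ
  i : ℕ
  acc : ℤ
  prod : ℤ
  F : ℤ
  W : ℕ → ℕ
  Fa : ℕ → ℤ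

/-- The memory that holds a state, for the inputs `n` and `k`: the variables and the inputs occupy
the cells `0, …, 9`, the pattern the `n` cells from `10` on, the table the cells from `10 + n`
on. -/
def State.mem (n k : ℕ) (σ : State) : Mem
  | 0 => σ.r
  | 1 => n
  | 2 => k
  | 3 => σ.m
  | 4 => σ.j
  | 5 => σ.b
  | 6 => σ.i
  | 7 => σ.acc
  | 8 => σ.prod
  | 9 => σ.F
  | a + 10 => if a < n then (σ.W a : ℤ) else σ.Fa (a - n)

section StateLemmas

variable (n k : ℕ) (σ : State)

@[simp] lemma mem_r : σ.mem n k 0 = σ.r := rfl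
@[simp] lemma mem_n : σ.mem n k 1 = n := rfl
@[simp] lemma mem_k : σ.mem n k 2 = k := rfl
@[simp] lemma mem_m : σ.mem n k 3 = σ.m := rfl
@[simp] lemma mem_j : σ.mem n k 4 = σ.j := rfl
@[simp] lemma mem_b : σ.mem n k 5 = σ.b := rfl
@[simp] lemma mem_i : σ.mem n k 6 = σ.i := rfl
@[simp] lemma mem_acc : σ.mem n k 7 = σ.acc := rfl
@[simp] lemma mem_prod : σ.mem n k 8 = σ.prod := rfl
@[simp] lemma mem_F : σ.mem n k 9 = σ.F := rfl

lemma mem_W {x : ℕ} (hx : x < n) : σ.mem n k (10 + x) = σ.W x := by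
  rw [Nat.add_comm]
  exact if_pos hx

lemma mem_Fa (x : ℕ) : σ.mem n k (10 + n + x) = σ.Fa x := by
  rw [show 10 + n + x = (n + x) + 10 by omega]
  refine (if_neg (by omega)).trans ?_
  simp

lemma mem_ext {f g : Mem} (h : ∀ a < 10, f a = g a) (h' : ∀ a, f (a + 10) = g (a + 10)) :
    f = g := by
  funext a
  rcases lt_or_ge a 10 with ha | ha
  · exact h a ha
  · obtain ⟨a, rfl⟩ := Nat.exists_eq_add_of_le' ha
    exact h' a

lemma update_r (z : ℤ) : Function.update (σ.mem n k) 0 z = State.mem n k { σ with r := z } := by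
  refine mem_ext (fun a ha => ?_) fun a => rfl
  interval_cases a <;> rfl

lemma update_m (x : ℕ) : Function.update (σ.mem n k) 3 x = State.mem n k { σ with m := x } := by
  refine mem_ext (fun a ha => ?_) fun a => rfl
  interval_cases a <;> rfl

lemma update_j (x : ℕ) : Function.update (σ.mem n k) 4 x = State.mem n k { σ with j := x } := by
  refine mem_ext (fun a ha => ?_) fun a => rfl
  interval_cases a <;> rfl

lemma update_b (x : ℕ) : Function.update (σ.mem n k) 5 x = State.mem n k { σ with b := x } := by
  refine mem_ext (fun a ha => ?_) fun a => rfl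
  interval_cases a <;> rfl

lemma update_i (x : ℕ) : Function.update (σ.mem n k) 6 x = State.mem n k { σ with i := x } := by
  refine mem_ext (fun a ha => ?_) fun a => rfl
  interval_cases a <;> rfl

lemma update_acc (z : ℤ) :
    Function.update (σ.mem n k) 7 z = State.mem n k { σ with acc := z } := by
  refine mem_ext (fun a ha => ?_) fun a => rfl
  interval_cases a <;> rfl

lemma update_prod (z : ℤ) :
    Function.update (σ.mem n k) 8 z = State.mem n k { σ with prod := z } := by
  refine mem_ext (fun a ha => ?_) fun a => rfl
  interval_cases a <;> rfl

lemma update_F (z : ℤ) : Function.update (σ.mem n k) 9 z = State.mem n k { σ with F := z } := by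
  refine mem_ext (fun a ha => ?_) fun a => rfl
  interval_cases a <;> rfl

lemma update_W {x : ℕ} (hx : x < n) (y : ℕ) : Function.update (σ.mem n k) (10 + x) y =
    State.mem n k { σ with W := Function.update σ.W x y } := by
  refine mem_ext (fun a ha => ?_) fun a => ?_
  · rw [Function.update_of_ne (by omega)]
    interval_cases a <;> rfl
  · rcases eq_or_ne a x with rfl | h
    · simp [Nat.add_comm 10 a, State.mem, hx]
    · rw [Function.update_of_ne (by omega)]
      simp [State.mem, h]

lemma update_Fa (x : ℕ) (z : ℤ) : Function.update (σ.mem n k) (10 + n + x) z =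
    State.mem n k { σ with Fa := Function.update σ.Fa x z } := by
  refine mem_ext (fun a ha => ?_) fun a => ?_
  · rw [Function.update_of_ne (by omega)]
    interval_cases a <;> rfl
  · rcases eq_or_ne a (n + x) with rfl | h
    · rw [show n + x + 10 = 10 + n + x by omega, mem_Fa]
      simp
    · rw [Function.update_of_ne (by omega)]
      simp only [State.mem]
      split_ifs with h1
      · rfl
      · rw [Function.update_of_ne (by omega)]

end StateLemmas

/-- Started in the state `σ`, the program `p` halts within `T` units of time in a state that
satisfies `Q`, and uses only the `11 + 2 * n` cells of the working memory. -/
def Run (n k : ℕ) (p : Prog) (T : ℕ) (σ : State) (Q : State → Prop) : Prop :=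
  ∃ t ≤ T, ∃ σ' : State, Exec (11 + 2 * n) p (σ.mem n k) t (σ'.mem n k) ∧ Q σ'

section Rules

variable {n k : ℕ} {σ : State} {Q : State → Prop}

lemma Run.mono {p : Prog} {T T' : ℕ} {Q' : State → Prop} (h : Run n k p T σ Q') (hT : T ≤ T')
    (hQ : ∀ σ', Q' σ' → Q σ') : Run n k p T' σ Q := by
  obtain ⟨t, ht, σ', he, hq⟩ := h
  exact ⟨t, ht.trans hT, σ', he, hQ _ hq⟩

lemma Run.skip {T : ℕ} (hT : 1 ≤ T) (hQ : Q σ) : Run n k .skip T σ Q :=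
  ⟨1, hT, σ, .skip _, hQ⟩

lemma Run.store {a e : Expr} {T : ℕ} {σ' : State} (x : ℕ)
    (hupd : Function.update (σ.mem n k) x (e.eval (σ.mem n k)) = σ'.mem n k)
    (hx : a.eval (σ.mem n k) = x) (hxn : x < 11 + 2 * n)
    (ha : a.Within (11 + 2 * n) (σ.mem n k)) (he : e.Within (11 + 2 * n) (σ.mem n k))
    (hT : a.cost + e.cost + 1 ≤ T) (hQ : Q σ') : Run n k (.store a e) T σ Q :=
  ⟨_, hT, σ', hupd ▸ .store a e _ x ha he hx hxn, hQ⟩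

lemma Run.seq {p q : Prog} {T : ℕ} (T₁ T₂ : ℕ) (hT : T₁ + T₂ ≤ T) {Q' : State → Prop}
    (h₁ : Run n k p T₁ σ Q') (h₂ : ∀ σ', Q' σ' → Run n k q T₂ σ' Q) :
    Run n k (.seq p q) T σ Q := by
  obtain ⟨t₁, ht₁, σ₁, he₁, hq₁⟩ := h₁
  obtain ⟨t₂, ht₂, σ₂, he₂, hq₂⟩ := h₂ σ₁ hq₁
  exact ⟨_, (Nat.add_le_add ht₁ ht₂).trans hT, σ₂, .seq _ _ _ _ _ _ _ he₁ he₂, hq₂⟩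

lemma Run.ite {c : Expr} {p q : Prog} {T : ℕ} (T' : ℕ) (hT : c.cost + 1 + T' ≤ T)
    (hc : c.Within (11 + 2 * n) (σ.mem n k))
    (h₁ : c.eval (σ.mem n k) ≠ 0 → Run n k p T' σ Q)
    (h₂ : c.eval (σ.mem n k) = 0 → Run n k q T' σ Q) :
    Run n k (.ite c p q) T σ Q := by
  by_cases h : c.eval (σ.mem n k) = 0
  · obtain ⟨t, ht, σ', he, hq⟩ := h₂ h
    exact ⟨_, (Nat.add_le_add_left ht _).trans hT, σ', .iteFalse _ _ _ _ _ _ hc h he, hq⟩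
  · obtain ⟨t, ht, σ', he, hq⟩ := h₁ h
    exact ⟨_, (Nat.add_le_add_left ht _).trans hT, σ', .iteTrue _ _ _ _ _ _ hc h he, hq⟩

/-- A loop that is passed `N` times, with an invariant indexed by the number of passes. -/
lemma Run.loop {c : Expr} {p : Prog} {B : ℕ} (N : ℕ) (I : ℕ → State → Prop) (h0 : I 0 σ)
    (hc : ∀ t ≤ N, ∀ σ, I t σ → c.Within (11 + 2 * n) (σ.mem n k))
    (hstep : ∀ t < N, ∀ σ, I t σ → c.eval (σ.mem n k) ≠ 0 ∧ Run n k p B σ (I (t + 1)))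
    (hend : ∀ σ, I N σ → c.eval (σ.mem n k) = 0) :
    Run n k (.loop c p) (N * (c.cost + 1 + B) + (c.cost + 1)) σ (I N) := by
  induction N generalizing I σ with
  | zero =>
    exact ⟨c.cost + 1, by simp, σ, .loopDone _ _ _ (hc 0 le_rfl σ h0) (hend σ h0), h0⟩
  | succ N ih =>
    obtain ⟨hne, t₁, ht₁, σ₁, he₁, hI₁⟩ := hstep 0 (Nat.succ_pos N) σ h0
    obtain ⟨t₂, ht₂, σ₂, he₂, hI₂⟩ := ih (σ := σ₁) (fun t => I (t + 1)) hI₁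
      (fun t ht => hc (t + 1) (by omega)) (fun t ht => hstep (t + 1) (by omega)) hend
    refine ⟨_, ?_, σ₂, .loopStep _ _ _ _ _ _ _ (hc 0 (by omega) σ h0) hne he₁ he₂, hI₂⟩
    rw [Nat.succ_mul]
    omega

end Rules

/-! ### The program

The cells `0, …, 9` hold `r`, `n`, `k`, `m`, `j`, `b`, `i`, `acc`, `prod`, `F`, in this order. -/

/-- The content of the cell `c`. -/
def cell (c : ℕ) : Expr := .load (.const c)

/-- Assignment to the cell `c`. -/
def set (c : ℕ) (e : Expr) : Prog := .store (.const c) e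

/-- Addition of `1` to the cell `c`. -/
def incr (c : ℕ) : Prog := set c (.bin .add (cell c) (.const 1))

/-- The address of the entry with index `e` in the pattern. -/
def addrW (e : Expr) : Expr := .bin .add (.const 10) e

/-- The address of the entry with index `e` in the table. -/
def addrFa (e : Expr) : Expr := .bin .add (.bin .add (.const 10) (cell 1)) e

/-- Multiplies `prod` by `choices k W j b i` and increments `i`. In the final copy of the border,
the product `W i * (W i - W (i - (j - b)))` is nonzero exactly if no letter fits. -/
def factorStep : Prog :=
  .seq
    (.ite (.bin .lt (cell 6) (.bin .sub (cell 4) (cell 5)))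
      (.ite (.load (addrW (cell 6))) .skip (set 8 (.bin .mul (cell 8) (cell 2))))
      (.ite (.bin .mul (.load (addrW (cell 6)))
          (.bin .sub (.load (addrW (cell 6)))
            (.load (addrW (.bin .sub (cell 6) (.bin .sub (cell 4) (cell 5)))))))
        (set 8 (.const 0)) .skip))
    (incr 6)

/-- Multiplies `prod` by all factors with indices from `i` up to `j - 1`. -/
def factorLoop : Prog := .loop (.bin .lt (cell 6) (cell 4)) factorStep

/-- Subtracts from `acc` the summand with index `b` of the recurrence. -/
def termStep : Prog :=
  .seq (set 8 (.load (addrFa (cell 5)))) <| .seq (set 6 (cell 5)) <| .seq factorLoop <|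
    .seq (set 7 (.bin .sub (cell 7) (cell 8))) (incr 5)

/-- The sum over all `b` with `2 * b ≤ j`. -/
def termLoop : Prog :=
  .loop (.bin .lt (.bin .add (cell 5) (cell 5)) (.bin .add (cell 4) (.const 1))) termStep

/-- Computes the table entry with index `j`. -/
def entryStep : Prog :=
  .seq (set 7 (.const 0)) <| .seq (set 5 (.const 0)) <| .seq termLoop <|
    .seq (.store (addrFa (cell 4)) (cell 7)) (incr 4)

/-- Fills the table from index `j` up to index `n`. -/
def entryLoop : Prog := .loop (.bin .lt (cell 4) (.bin .add (cell 1) (.const 1))) entryStep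

/-- Passes from the current letter at position `m` to the next one. -/
def letterStep : Prog :=
  .seq (set 0 (.bin .sub (cell 0) (cell 9))) <|
    .seq (.store (addrW (cell 3)) (.bin .add (.load (addrW (cell 3))) (.const 1))) <|
      .seq (set 4 (.const 1)) <| .seq entryLoop (set 9 (.load (addrFa (cell 1))))

/-- Finds the letter at position `m`. The scan starts from the value `0` with `F = 0`, so that its
first step leaves `r` unchanged and passes to the letter `1`. -/
def letterLoop : Prog := .loop (.bin .lt (cell 9) (cell 0)) letterStep

/-- Finds the letter at position `m` and increments `m`. -/
def positionStep : Prog := .seq (set 9 (.const 0)) <| .seq letterLoop (incr 3)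

/-- The unranking program. The entry `-1` at index `0` of the table is written once and never
changed; the pattern and `m` are initially `0`. -/
def unrank : Prog :=
  .seq (.store (addrFa (.const 0)) (.const (-1)))
    (.loop (.bin .lt (cell 3) (cell 1)) positionStep)

/-! ### Correctness and running time of the evaluation of the recurrence -/

section Cells

variable (n k : ℕ) (σ : State)

@[simp] lemma eval_cell (m : Mem) (c : ℕ) : (cell c).eval m = m c := by
  simp [cell, Expr.eval]

@[simp] lemma cost_cell (c : ℕ) : (cell c).cost = 2 := rfl

lemma within_cell (m : Mem) {c s : ℕ} (h : c < s) : (cell c).Within s m := by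
  simpa [cell, Expr.Within, Expr.eval] using h

variable {n k σ}

lemma eval_load_addrW {e : Expr} {x : ℕ} (he : e.eval (σ.mem n k) = x) (hx : x < n) :
    (Expr.load (addrW e)).eval (σ.mem n k) = σ.W x := by
  rw [← mem_W n k σ hx]
  simp only [addrW, Expr.eval, Op.eval, he]
  congr 1

lemma within_load_addrW {e : Expr} {x : ℕ} (h : e.Within (11 + 2 * n) (σ.mem n k))
    (he : e.eval (σ.mem n k) = x) (hx : x < n) :
    (Expr.load (addrW e)).Within (11 + 2 * n) (σ.mem n k) := by
  refine ⟨⟨trivial, h⟩, ?_⟩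
  simp only [addrW, Expr.eval, Op.eval, he]
  push_cast
  omega

lemma eval_addrFa {e : Expr} {x : ℕ} (he : e.eval (σ.mem n k) = x) :
    (addrFa e).eval (σ.mem n k) = (10 + n + x : ℕ) := by
  simp [addrFa, Expr.eval, Op.eval, he]

lemma within_addrFa {e : Expr} (h : e.Within (11 + 2 * n) (σ.mem n k)) :
    (addrFa e).Within (11 + 2 * n) (σ.mem n k) :=
  ⟨⟨trivial, within_cell _ (by omega)⟩, h⟩

lemma eval_load_addrFa {e : Expr} {x : ℕ} (he : e.eval (σ.mem n k) = x) :
    (Expr.load (addrFa e)).eval (σ.mem n k) = σ.Fa x := by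
  rw [← mem_Fa n k σ x, Expr.eval, eval_addrFa he, Int.toNat_natCast]

lemma within_load_addrFa {e : Expr} {x : ℕ} (h : e.Within (11 + 2 * n) (σ.mem n k))
    (he : e.eval (σ.mem n k) = x) (hx : x ≤ n) :
    (Expr.load (addrFa e)).Within (11 + 2 * n) (σ.mem n k) := by
  refine ⟨within_addrFa h, ?_⟩
  rw [eval_addrFa he]
  push_cast
  omega

end Cells

section Correctness

variable {n k : ℕ} {σ : State} {Q : State → Prop}

/-- Assignment to one of the cells `0, …, 9`, which hold the variables and the inputs. -/
lemma Run.set {e : Expr} {T : ℕ} {σ' : State} {x : ℕ} (hx : x < 10)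
    (hupd : Function.update (σ.mem n k) x (e.eval (σ.mem n k)) = σ'.mem n k)
    (he : e.Within (11 + 2 * n) (σ.mem n k)) (hT : e.cost + 2 ≤ T) (hQ : Q σ') :
    Run n k (RAM.set x e) T σ Q :=
  Run.store (a := .const x) x hupd rfl (by omega) trivial he
    (by simp only [Expr.cost]; omega) hQ

lemma eval_bin (o : Op) (a b : Expr) (m : Mem) :
    (Expr.bin o a b).eval m = o.eval (a.eval m) (b.eval m) := rfl

lemma within_bin {o : Op} {a b : Expr} {s : ℕ} {m : Mem} (ha : a.Within s m) (hb : b.Within s m) :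
    (Expr.bin o a b).Within s m := ⟨ha, hb⟩

lemma within_var {c : ℕ} (hc : c < 10) : (cell c).Within (11 + 2 * n) (σ.mem n k) :=
  within_cell _ (by omega)

lemma within_bin_var {o : Op} {c d : ℕ} (hc : c < 10) (hd : d < 10) :
    (Expr.bin o (cell c) (cell d)).Within (11 + 2 * n) (σ.mem n k) :=
  ⟨within_var hc, within_var hd⟩

lemma within_incr {c : ℕ} (hc : c < 10) :
    (Expr.bin .add (cell c) (.const 1)).Within (11 + 2 * n) (σ.mem n k) :=
  ⟨within_var hc, trivial⟩

lemma run_incr_m : Run n k (incr 3) 6 σ fun σ' => σ' = { σ with m := σ.m + 1 } :=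
  Run.set (by omega) (by simpa [Expr.eval, Op.eval] using update_m n k σ (σ.m + 1))
    (within_incr (by omega)) (by simp [Expr.cost]) rfl

lemma run_incr_j : Run n k (incr 4) 6 σ fun σ' => σ' = { σ with j := σ.j + 1 } :=
  Run.set (by omega) (by simpa [Expr.eval, Op.eval] using update_j n k σ (σ.j + 1))
    (within_incr (by omega)) (by simp [Expr.cost]) rfl

lemma run_incr_b : Run n k (incr 5) 6 σ fun σ' => σ' = { σ with b := σ.b + 1 } :=
  Run.set (by omega) (by simpa [Expr.eval, Op.eval] using update_b n k σ (σ.b + 1))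
    (within_incr (by omega)) (by simp [Expr.cost]) rfl

lemma run_incr_i : Run n k (incr 6) 6 σ fun σ' => σ' = { σ with i := σ.i + 1 } :=
  Run.set (by omega) (by simpa [Expr.eval, Op.eval] using update_i n k σ (σ.i + 1))
    (within_incr (by omega)) (by simp [Expr.cost]) rfl

lemma run_factorStep (hb : σ.b ≤ σ.j) (hj : σ.j ≤ n) (hi : σ.i < σ.j) :
    Run n k factorStep 50 σ fun σ' => σ' =
      { σ with i := σ.i + 1, prod := σ.prod * choices k σ.W σ.j σ.b σ.i } := by
  have hbj : (Expr.bin .sub (cell 4) (cell 5)).eval (σ.mem n k) = (σ.j - σ.b : ℕ) := by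
    simp [Expr.eval, Op.eval, Nat.cast_sub hb]
  have hbjw : (Expr.bin .sub (cell 4) (cell 5)).Within (11 + 2 * n) (σ.mem n k) :=
    within_bin_var (by omega) (by omega)
  have hW : (Expr.load (addrW (cell 6))).eval (σ.mem n k) = σ.W σ.i :=
    eval_load_addrW (by simp) (by omega)
  have hWw : (Expr.load (addrW (cell 6))).Within (11 + 2 * n) (σ.mem n k) :=
    within_load_addrW (x := σ.i) (within_var (by omega)) (by simp) (by omega)
  refine Run.seq 44 6 (by norm_num) (Q' := fun σ' => σ' =
    { σ with prod := σ.prod * choices k σ.W σ.j σ.b σ.i }) ?_ ?_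
  · refine Run.ite 35 (by simp [Expr.cost]) (within_bin (within_var (by omega)) hbjw)
      (fun h => ?_) (fun h => ?_)
    · have hlt : σ.i < σ.j - σ.b := by
        by_contra hlt
        rw [eval_bin, hbj] at h
        simp [Op.eval, hlt, -Nat.cast_sub] at h
      refine Run.ite 10 (by simp [Expr.cost, addrW]) hWw (fun h => ?_) (fun h => ?_)
      · rw [hW] at h
        refine Run.skip (by norm_num) ?_
        have : σ.W σ.i ≠ 0 := by exact_mod_cast h
        simp [choices, hlt, this]
      · rw [hW] at h
        have : σ.W σ.i = 0 := by exact_mod_cast h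
        refine Run.set (by omega) (update_prod _ _ _ _)
          (within_bin_var (by omega) (by omega)) (by simp [Expr.cost]) ?_
        simp [choices, hlt, this, Expr.eval, Op.eval]
    · have hlt : ¬ σ.i < σ.j - σ.b := by
        intro hlt
        rw [eval_bin, hbj] at h
        simp [Op.eval, hlt, -Nat.cast_sub] at h
      have hd : (Expr.bin .sub (cell 6) (.bin .sub (cell 4) (cell 5))).eval (σ.mem n k) =
          (σ.i - (σ.j - σ.b) : ℕ) := by
        rw [Nat.cast_sub (not_lt.1 hlt), ← hbj]
        simp [Expr.eval, Op.eval]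
      have hV := eval_load_addrW hd (by omega)
      have hVw := within_load_addrW (within_bin (within_var (by omega)) hbjw) hd (by omega)
      refine Run.ite 10 (by simp [Expr.cost, addrW]) (within_bin hWw (within_bin hWw hVw))
        (fun h => ?_) (fun h => ?_)
      · rw [eval_bin, eval_bin, hW, hV] at h
        refine Run.set (by omega) (update_prod _ _ _ _) trivial (by simp [Expr.cost]) ?_
        have : ¬ (σ.W σ.i = 0 ∨ σ.W σ.i = σ.W (σ.i - (σ.j - σ.b))) := by
          rintro (h1 | h1)
          · simp [Op.eval, h1] at h
          · simp [Op.eval, ← h1] at h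
        simp [choices, hlt, this, Expr.eval]
      · rw [eval_bin, eval_bin, hW, hV] at h
        refine Run.skip (by norm_num) ?_
        have : σ.W σ.i = 0 ∨ σ.W σ.i = σ.W (σ.i - (σ.j - σ.b)) := by
          rcases mul_eq_zero.1 h with h1 | h1
          · exact Or.inl (by exact_mod_cast h1)
          · exact Or.inr (by exact_mod_cast sub_eq_zero.1 h1)
        simp [choices, hlt, this]
  · rintro _ rfl
    exact run_incr_i

lemma run_factorLoop (hb : σ.b ≤ σ.j) (hj : σ.j ≤ n) (hi : σ.i = σ.b) :
    Run n k factorLoop (60 * (n + 1)) σ fun σ' => σ' =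
      { σ with i := σ.j, prod := σ.prod * ∏ i ∈ Ico σ.b σ.j, (choices k σ.W σ.j σ.b i : ℤ) } := by
  refine (Run.loop (σ.j - σ.b) (B := 50) (fun t σ' => σ' =
    { σ with
      i := σ.b + t
      prod := σ.prod * ∏ i ∈ Ico σ.b (σ.b + t), (choices k σ.W σ.j σ.b i : ℤ) })
    ?_ ?_ ?_ ?_).mono ?_ ?_
  · cases σ
    simp_all
  · exact fun t _ σ' _ => within_bin_var (by omega) (by omega)
  · rintro t ht _ rfl
    refine ⟨?_, ?_⟩
    · simp [Expr.eval, Op.eval]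
      omega
    · refine (run_factorStep (by simpa using hb) (by simpa using hj) (by simp; omega)).mono
        le_rfl ?_
      rintro _ rfl
      simp only [← Nat.add_assoc]
      rw [prod_Ico_succ_top (by omega), mul_assoc]
  · rintro _ rfl
    simp [Expr.eval, Op.eval]
    omega
  · simp only [Expr.cost, cost_cell]
    have : σ.j - σ.b ≤ n := by omega
    omega
  · rintro _ rfl
    simp [Nat.add_sub_cancel' hb]

lemma run_termStep (hb : σ.b ≤ σ.j) (hj : σ.j ≤ n) :
    Run n k termStep (60 * (n + 1) + 40) σ fun σ' => ∃ x y, σ' =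
      { σ with
        b := σ.b + 1
        i := x
        prod := y
        acc := σ.acc - σ.Fa σ.b * ∏ i ∈ Ico σ.b σ.j, (choices k σ.W σ.j σ.b i : ℤ) } := by
  refine Run.seq 12 (4 + (60 * (n + 1) + (7 + 6))) (by omega)
    (Q' := fun σ' => σ' = { σ with prod := σ.Fa σ.b })
    (Run.set (by omega) ?_
      (within_load_addrFa (x := σ.b) (within_var (by omega)) (by simp) (by omega))
      (by simp [Expr.cost, addrFa]) rfl) ?_
  · rw [eval_load_addrFa (x := σ.b) (by simp)]
    exact update_prod ..
  rintro _ rfl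
  refine Run.seq 4 _ le_rfl (Q' := fun σ' => σ' = { σ with prod := σ.Fa σ.b, i := σ.b })
    (Run.set (by omega) ?_ (within_var (by omega)) (by simp) rfl) ?_
  · simpa using update_i n k _ σ.b
  rintro _ rfl
  refine Run.seq _ _ le_rfl (run_factorLoop (by simpa using hb) (by simpa using hj) rfl) ?_
  rintro _ rfl
  refine Run.seq 7 _ le_rfl (Run.set (Q := fun σ' => σ' =
    { σ with
      i := σ.j
      prod := σ.Fa σ.b * ∏ i ∈ Ico σ.b σ.j, (choices k σ.W σ.j σ.b i : ℤ)
      acc := σ.acc - σ.Fa σ.b * ∏ i ∈ Ico σ.b σ.j, (choices k σ.W σ.j σ.b i : ℤ) })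
    (by omega) (update_acc ..) (within_bin_var (by omega) (by omega)) (by simp [Expr.cost]) ?_) ?_
  · simp [Expr.eval, Op.eval]
  rintro _ rfl
  exact run_incr_b.mono le_rfl fun _ h => ⟨_, _, h⟩

/-- The sum in the recurrence, including the summand `b = 0`, yields the table entry at `j`. -/
lemma run_termLoop (hj0 : 0 < σ.j) (hj : σ.j ≤ n) (hb : σ.b = 0) (hacc : σ.acc = 0)
    (hP : ∀ i i', i ≤ i' → σ.W i = 0 → σ.W i' = 0) (hPk : ∀ i, σ.W i ≤ k)
    (hFa : ∀ x < σ.j, σ.Fa x = countTable k σ.W x) :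
    Run n k termLoop (150 * (n + 1) ^ 2) σ fun σ' => ∃ x y z, σ' =
      { σ with b := x, i := y, prod := z, acc := countTable k σ.W σ.j } := by
  refine (Run.loop (σ.j / 2 + 1) (B := 60 * (n + 1) + 40) (fun t σ' => ∃ x y, σ' =
    { σ with
      b := t
      i := x
      prod := y
      acc := - ∑ b ∈ range t, countTable k σ.W b *
        ∏ i ∈ Ico b σ.j, (choices k σ.W σ.j b i : ℤ) }) ?_ ?_ ?_ ?_).mono ?_ ?_
  · refine ⟨σ.i, σ.prod, ?_⟩
    cases σ
    simp_all
  · exact fun t _ σ' _ => within_bin (within_bin_var (by omega) (by omega)) (within_incr (by omega))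
  · rintro t ht _ ⟨x, y, rfl⟩
    refine ⟨?_, ?_⟩
    · simp [Expr.eval, Op.eval]
      omega
    · refine (run_termStep (by simp; omega) (by simpa using hj)).mono le_rfl ?_
      rintro _ ⟨x', y', rfl⟩
      refine ⟨x', y', ?_⟩
      simp only [sum_range_succ, neg_add, sub_eq_add_neg]
      rw [hFa t (by omega)]
  · rintro _ ⟨x, y, rfl⟩
    simp [Expr.eval, Op.eval]
    omega
  · simp only [Expr.cost, cost_cell]
    have : σ.j / 2 + 1 ≤ n + 1 := by omega
    nlinarith
  · rintro _ ⟨x, y, rfl⟩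
    exact ⟨_, x, y, by rw [countTable_eq k σ.W hP hPk hj0]⟩

lemma run_entryStep (hj0 : 0 < σ.j) (hj : σ.j ≤ n)
    (hP : ∀ i i', i ≤ i' → σ.W i = 0 → σ.W i' = 0) (hPk : ∀ i, σ.W i ≤ k)
    (hFa : ∀ x < σ.j, σ.Fa x = countTable k σ.W x) :
    Run n k entryStep (180 * (n + 1) ^ 2) σ fun σ' => σ'.r = σ.r ∧ σ'.m = σ.m ∧ σ'.W = σ.W ∧
      σ'.j = σ.j + 1 ∧ ∀ x < σ.j + 1, σ'.Fa x = countTable k σ.W x := by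
  refine Run.seq 3 (3 + (150 * (n + 1) ^ 2 + (10 + 6))) (by nlinarith)
    (Q' := fun σ' => σ' = { σ with acc := 0 })
    (Run.set (by omega) (update_acc ..) trivial (by simp [Expr.cost]) rfl) ?_
  rintro _ rfl
  refine Run.seq 3 _ le_rfl (Q' := fun σ' => σ' = { σ with acc := 0, b := 0 })
    (Run.set (by omega) (update_b n k _ 0) trivial (by simp [Expr.cost]) rfl) ?_
  rintro _ rfl
  refine Run.seq _ _ le_rfl (run_termLoop (by simpa using hj0) (by simpa using hj) rfl rfl
    (by simpa using hP) (by simpa using hPk) (by simpa using hFa)) ?_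
  rintro _ ⟨x, y, z, rfl⟩
  refine Run.seq 10 _ le_rfl (Q' := fun σ' => σ' = _)
    (Run.store (10 + n + σ.j) (update_Fa ..) (eval_addrFa (by simp)) (by omega)
      (within_addrFa (within_var (by omega))) (within_var (by omega))
      (by simp [Expr.cost, addrFa]) rfl) ?_
  rintro _ rfl
  refine run_incr_j.mono le_rfl ?_
  rintro _ rfl
  refine ⟨rfl, rfl, rfl, rfl, fun x hx => ?_⟩
  rcases eq_or_ne x σ.j with rfl | h
  · simp
  · simpa [h] using hFa x (by omega)

lemma run_entryLoop (hj : σ.j = 1) (hFa : σ.Fa 0 = -1)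
    (hP : ∀ i i', i ≤ i' → σ.W i = 0 → σ.W i' = 0) (hPk : ∀ i, σ.W i ≤ k) :
    Run n k entryLoop (200 * (n + 1) ^ 3) σ fun σ' => σ'.r = σ.r ∧ σ'.m = σ.m ∧ σ'.W = σ.W ∧
      ∀ x < n + 1, σ'.Fa x = countTable k σ.W x := by
  refine (Run.loop n (B := 180 * (n + 1) ^ 2) (fun t σ' => (σ'.r = σ.r ∧ σ'.m = σ.m ∧
    σ'.W = σ.W) ∧ σ'.j = t + 1 ∧ ∀ x < t + 1, σ'.Fa x = countTable k σ.W x)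
    ?_ ?_ ?_ ?_).mono ?_ ?_
  · refine ⟨⟨rfl, rfl, rfl⟩, hj, fun x hx => ?_⟩
    obtain rfl : x = 0 := by omega
    simpa [countTable] using hFa
  · exact fun t _ σ' _ => within_bin (within_var (by omega)) (within_incr (by omega))
  · rintro t ht σ' ⟨⟨h1, h2, h3⟩, h4, h5⟩
    refine ⟨?_, ?_⟩
    · simp [Expr.eval, Op.eval, h4]
      omega
    · refine (run_entryStep (by omega) (by omega) (h3 ▸ hP) (h3 ▸ hPk)
        (by rw [h4, h3]; exact h5)).mono le_rfl ?_
      rintro σ'' ⟨g1, g2, g3, g4, g5⟩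
      rw [h4] at g4
      rw [h3, h4] at g5
      exact ⟨⟨g1.trans h1, g2.trans h2, g3.trans h3⟩, g4, g5⟩
  · rintro σ' ⟨-, h4, -⟩
    simp [Expr.eval, Op.eval, h4]
  · simp only [Expr.cost, cost_cell]
    have : 1 ≤ (n + 1) ^ 2 := Nat.one_le_pow _ _ (by omega)
    rw [pow_succ (n + 1) 2]
    nlinarith
  · rintro σ' ⟨⟨h1, h2, h3⟩, -, h5⟩
    exact ⟨h1, h2, h3, h5⟩

end Correctness

end RAM

/-! ### Patterns of the unranking algorithm -/

lemma prefixPattern_holes {k n : ℕ} {w : List ℕ} (hw : w ∈ unborderedWords k n) {m c : ℕ}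
    (hm : m < n) (hc : 0 < c) (i i' : ℕ) (hi : i ≤ i') (h : prefixPattern w m c i = 0) :
    prefixPattern w m c i' = 0 := by
  have hwk := (mem_unborderedWords.1 hw).2.1
  unfold prefixPattern at *
  split_ifs at h with h1 h2
  · have := mem_Icc.1 (hwk i (by omega))
    omega
  · omega
  · rw [if_neg (by omega), if_neg (by omega)]

lemma prefixPattern_le {k n : ℕ} {w : List ℕ} (hw : w ∈ unborderedWords k n) {m c : ℕ}
    (hm : m < n) (hc : c ≤ k) (i : ℕ) : prefixPattern w m c i ≤ k := by
  unfold prefixPattern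
  split_ifs with h1 h2
  · exact (mem_Icc.1 ((mem_unborderedWords.1 hw).2.1 i (by omega))).2
  · exact hc
  · exact Nat.zero_le _

lemma update_prefixPattern (w : List ℕ) (m c c' : ℕ) :
    Function.update (prefixPattern w m c) m c' = prefixPattern w m c' := by
  funext i
  rcases eq_or_ne i m with rfl | h
  · simp [prefixPattern]
  · simp [prefixPattern, h]

lemma prefixPattern_succ_zero (w : List ℕ) (m : ℕ) :
    prefixPattern w (m + 1) 0 = prefixPattern w m (w.getD m 0) := by
  funext i
  unfold prefixPattern
  rcases lt_trichotomy i m with h | rfl | h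
  · rw [if_pos (by omega), if_pos h]
  · simp
  · rw [if_neg (by omega), ite_self, if_neg (by omega), if_neg (by omega)]

/-! ### Correctness and running time of the search for the letters -/

namespace RAM

variable {n k : ℕ} {σ : State}

/-- One step of the scan over the letters at position `m`, from the letter `c` to `c + 1`. -/
lemma run_letterStep {w : List ℕ} (hw : w ∈ unborderedWords k n) {m c : ℕ} (hm : m < n)
    (hc : c < w.getD m 0) (hσm : σ.m = m) (hr : σ.r = remRank k n w m c)
    (hF : σ.F = extCount k n w m c) (hW : σ.W = prefixPattern w m c) (hFa : σ.Fa 0 = -1) :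
    Run n k letterStep (240 * (n + 1) ^ 3) σ fun σ' => σ'.m = m ∧
      σ'.r = remRank k n w m (c + 1) ∧ σ'.F = extCount k n w m (c + 1) ∧
      σ'.W = prefixPattern w m (c + 1) ∧ σ'.Fa 0 = -1 := by
  have hck : c + 1 ≤ k := by
    have := mem_Icc.1 ((mem_unborderedWords.1 hw).2.1 m hm)
    omega
  have h1 : 1 ≤ (n + 1) ^ 3 := Nat.one_le_pow _ _ (by omega)
  refine Run.seq 7 (12 + (3 + (200 * (n + 1) ^ 3 + 10))) (by omega)
    (Q' := fun σ' => σ' = { σ with r := remRank k n w m (c + 1) })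
    (Run.set (by omega) (update_r ..) (within_bin_var (by omega) (by omega))
      (by simp [Expr.cost]) ?_) ?_
  · have := remRank_eq_add hw hm hc
    simp [Expr.eval, Op.eval, hr, hF, this]
  rintro _ rfl
  refine Run.seq 12 _ le_rfl (Q' := fun σ' => σ' =
      { σ with r := remRank k n w m (c + 1), W := prefixPattern w m (c + 1) })
    (Run.store (10 + m) ?_ ?_ (by omega) (within_bin trivial (within_var (by omega)))
      (within_bin (within_load_addrW (x := m) (within_var (by omega)) (by simp [hσm]) hm) trivial)
      (by simp [Expr.cost, addrW]) rfl) ?_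
  · rw [eval_bin, eval_load_addrW (x := m) (by simp [hσm]) hm]
    have := update_W n k { σ with r := remRank k n w m (c + 1) } hm (c + 1)
    simp only [hW, update_prefixPattern] at this
    simpa [hW, prefixPattern, Op.eval, Expr.eval] using this
  · simp [addrW, Expr.eval, Op.eval, hσm]
  rintro _ rfl
  refine Run.seq 3 _ le_rfl (Q' := fun σ' => σ' =
      { σ with r := remRank k n w m (c + 1), W := prefixPattern w m (c + 1), j := 1 })
    (Run.set (by omega) (update_j n k _ 1) trivial (by simp [Expr.cost]) rfl) ?_
  rintro _ rfl
  refine Run.seq _ _ le_rfl (run_entryLoop rfl hFa (prefixPattern_holes hw hm (Nat.succ_pos c))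
    (prefixPattern_le hw hm hck)) ?_
  rintro σ' ⟨g1, g2, g3, g4⟩
  refine Run.set (by omega) (update_F ..)
    (within_load_addrFa (x := n) (within_var (by omega)) (by simp) le_rfl)
    (by simp [Expr.cost, addrFa]) ⟨g2.trans hσm, g1, ?_, g3, ?_⟩
  · rw [eval_load_addrFa (x := n) (by simp), g4 n (by omega), countTable, if_neg (by omega)]
    exact congrArg Nat.cast (unbCount_prefixPattern hw hm (Nat.succ_pos c) hck)
  · exact (g4 0 (by omega)).trans rfl

lemma run_positionStep {w : List ℕ} (hw : w ∈ unborderedWords k n) {m : ℕ} (hm : m < n)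
    (hσm : σ.m = m) (hr : σ.r = remRank k n w m 0) (hW : σ.W = prefixPattern w m 0)
    (hFa : σ.Fa 0 = -1) :
    Run n k positionStep (260 * (n + 1) ^ 3 * (k + 1)) σ fun σ' => σ'.m = m + 1 ∧
      σ'.r = remRank k n w (m + 1) 0 ∧ σ'.W = prefixPattern w (m + 1) 0 ∧ σ'.Fa 0 = -1 := by
  have hck : w.getD m 0 ≤ k := (mem_Icc.1 ((mem_unborderedWords.1 hw).2.1 m hm)).2
  have h1 : 1 ≤ (n + 1) ^ 3 := Nat.one_le_pow _ _ (by omega)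
  refine Run.seq 3 (250 * (n + 1) ^ 3 * (k + 1) + 6) (by nlinarith)
    (Q' := fun σ' => σ' = { σ with F := 0 })
    (Run.set (by omega) (update_F ..) trivial (by simp [Expr.cost]) rfl) ?_
  rintro _ rfl
  refine Run.seq _ _ le_rfl ((Run.loop (w.getD m 0) (B := 240 * (n + 1) ^ 3) (fun t σ' =>
    σ'.m = m ∧ σ'.r = remRank k n w m t ∧ σ'.F = extCount k n w m t ∧
      σ'.W = prefixPattern w m t ∧ σ'.Fa 0 = -1) ?_ ?_ ?_ ?_).mono ?_ fun _ h => h) ?_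
  · exact ⟨hσm, hr, by simp [extCount_zero w hm], hW, hFa⟩
  · exact fun t _ σ' _ => within_bin_var (by omega) (by omega)
  · rintro t ht σ' ⟨g1, g2, g3, g4, g5⟩
    refine ⟨?_, run_letterStep hw hm ht g1 g2 g3 g4 g5⟩
    simpa [Expr.eval, Op.eval, g2, g3] using extCount_lt_remRank hw hm ht
  · rintro σ' ⟨g1, g2, g3, g4, g5⟩
    simp only [Expr.eval, Op.eval, eval_cell, mem_r, mem_F, g2, g3]
    exact if_neg (by exact_mod_cast not_lt.2 (remRank_le_extCount hw hm))
  · simp only [Expr.cost, cost_cell]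
    have := Nat.mul_le_mul_right (2 + 2 + 1 + 1 + 240 * (n + 1) ^ 3) hck
    nlinarith
  · rintro σ' ⟨g1, g2, g3, g4, g5⟩
    refine run_incr_m.mono le_rfl ?_
    rintro _ rfl
    rw [remRank_succ hw hm, prefixPattern_succ_zero]
    exact ⟨by simp [g1], g2, g4, g5⟩

lemma run_unrank {w : List ℕ} (hw : w ∈ unborderedWords k n) (hm : σ.m = 0)
    (hr : σ.r = rankU k w) (hW : ∀ i, σ.W i = 0) :
    Run n k unrank (280 * (n + 1) ^ 4 * (k + 1)) σ fun σ' => ∀ i < n, σ'.W i = w.getD i 0 := by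
  have h1 : 1 ≤ (n + 1) ^ 3 := Nat.one_le_pow _ _ (by omega)
  have h2 : (n + 1) ^ 4 = n * (n + 1) ^ 3 + (n + 1) ^ 3 := by ring
  have h3 : 1 ≤ (n + 1) ^ 4 * (k + 1) := Nat.succ_le_of_lt (by positivity)
  refine Run.seq 8 (270 * (n + 1) ^ 4 * (k + 1)) (by linarith)
    (Q' := fun σ' => σ' = { σ with Fa := Function.update σ.Fa 0 (-1) })
    (Run.store (10 + n + 0) (update_Fa ..) (eval_addrFa rfl) (by omega)
      (within_addrFa trivial) trivial (by simp [Expr.cost, addrFa]) rfl) ?_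
  rintro _ rfl
  refine (Run.loop n (B := 260 * (n + 1) ^ 3 * (k + 1)) (fun t σ' =>
    σ'.m = t ∧ σ'.r = remRank k n w t 0 ∧ σ'.W = prefixPattern w t 0 ∧ σ'.Fa 0 = -1)
    ?_ ?_ ?_ ?_).mono ?_ ?_
  · refine ⟨hm, by simpa [remRank_zero_zero hw] using hr, ?_, by simp⟩
    funext i
    simp [hW, prefixPattern]
  · exact fun t _ σ' _ => within_bin_var (by omega) (by omega)
  · rintro t ht σ' ⟨g1, g2, g3, g4⟩
    refine ⟨?_, run_positionStep hw ht g1 g2 g3 g4⟩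
    simpa [Expr.eval, Op.eval, g1] using ht
  · rintro σ' ⟨g1, -⟩
    simp [Expr.eval, Op.eval, g1]
  · simp only [Expr.cost, cost_cell]
    rw [h2]
    nlinarith [Nat.mul_le_mul_left n h1, Nat.zero_le (n * k), Nat.zero_le (n * (n + 1) ^ 3 * k),
      Nat.mul_le_mul_left (n * k) h1, Nat.zero_le ((n + 1) ^ 3 * k)]
  · rintro σ' ⟨-, -, g3, -⟩ i hi
    rw [g3, prefixPattern, if_pos hi]

/-- The initial memory is that of a state without letters. -/
lemma input_eq (r n k : ℕ) :
    input [r, n, k] = State.mem n k ⟨r, 0, 0, 0, 0, 0, 0, 0, fun _ => 0, fun _ => 0⟩ := by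
  refine mem_ext (fun a ha => ?_) fun a => ?_
  · interval_cases a <;> rfl
  · simp [input, State.mem]

end RAM

theorem theorem12 :
    ∃ (p : RAM.Prog) (out : ℕ) (C : ℝ), ∀ n k : ℕ, 1 ≤ n → 2 ≤ k →
      ∀ (r : ℕ) (w : List ℕ), w ∈ unborderedWords k n → rankU k w = r →
        ∃ t s : ℕ, RAM.Computes p out [r, n, k] w t s ∧
          (t : ℝ) ≤ C * ((n : ℝ) ^ 4 * (k : ℝ) * Real.log (k : ℝ)) ∧
          (s : ℝ) ≤ C * (n : ℝ) := by
  refine ⟨RAM.unrank, 10, 14000, fun n k hn hk r w hw hr => ?_⟩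
  have hwl := (mem_unborderedWords.1 hw).1
  obtain ⟨t, ht, σ, hex, hσ⟩ := RAM.run_unrank
    (σ := ⟨r, 0, 0, 0, 0, 0, 0, 0, fun _ => 0, fun _ => 0⟩)
    hw rfl (by simp [hr]) fun _ => rfl
  have hn' : (1 : ℝ) ≤ n := by exact_mod_cast hn
  have hk' : (2 : ℝ) ≤ k := by exact_mod_cast hk
  refine ⟨t, 11 + 2 * n, ⟨by simp; omega, by omega, _, RAM.input_eq r n k ▸ hex, fun i hi => ?_⟩,
    ?_, ?_⟩
  · rw [RAM.mem_W n k σ (by omega), hσ i (by omega)]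
    simp [hi]
  · have hlog : 1 / 2 ≤ Real.log k := by
      have h1 := Real.log_two_gt_d9
      have h2 := Real.log_le_log (by norm_num) hk'
      linarith
    have h1 : (t : ℝ) ≤ 280 * (n + 1) ^ 4 * (k + 1) := by exact_mod_cast ht
    calc (t : ℝ) ≤ 280 * (n + 1) ^ 4 * (k + 1) := h1
      _ ≤ 280 * (2 * n) ^ 4 * (3 / 2 * k) := by gcongr <;> linarith
      _ = 13440 * (n ^ 4 * k * (1 / 2)) := by ring
      _ ≤ 14000 * (n ^ 4 * k * Real.log k) := by gcongr; norm_num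
  · push_cast
    linarith
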